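/- Let $M>0$, let $\mathbb{T}_M=\mathbb{R}/M\mathbb{Z}$, let $\mathcal{S}(\mathbb{T}_M)$ be the space of real-valued $M$-periodic $C^\infty$ functions, and let $\mathcal{M}(\mathbb{T}_M)$ be the space of $M$-periodic finite signed Radon measures, that is, of finite signed Borel measures on $\mathbb{T}_M$. For $w\in\mathcal{M}(\mathbb{T}_M)$ and $\varphi\in\mathcal{S}(\mathbb{T}_M)$ write $\langle w,\varphi\rangle=\int_{\mathbb{T}_M}\varphi\,\mathrm{d}w$. The RI-TV (TV-$\ell_2$) norm of $\mathbf{w}=(w_1,w_2)\in\mathcal{M}(\mathbb{T}_M)^2$ is $$\mathcal{R}(\mathbf{w})=\sup\Big\{\langle w_1,\varphi_1\rangle+\langle w_2,\varphi_2\rangle:\ \varphi_1,\varphi_2\in\mathcal{S}(\mathbb{T}_M),\ \sup_{t\in\mathbb{T}_M}\|(\varphi_1(t),\varphi_2(t))\|_2=1\Big\}.$$ Let $\mathrm{III}_M(\cdot-t_0)=\sum_{k\in\mathbb{Z}}\delta(\cdot-t_0-Mk)$ be the $M$-periodic Dirac comb shifted by $t_0$; as an element of $\mathcal{M}(\mathbb{T}_M)$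 it is the unit point mass at $t_0$. Then, for every $\mathbf{w}^*\in\mathcal{M}(\mathbb{T}_M)^2$, the following are equivalent: 1. $\mathbf{w}^*$ is an extreme point of the unit ball $\{\mathbf{w}\in\mathcal{M}(\mathbb{T}_M)^2:\mathcal{R}(\mathbf{w})\le 1\}$; 2. $\mathbf{w}^*$ is an extreme point of the unit sphere $\{\mathbf{w}\in\mathcal{M}(\mathbb{T}_M)^2:\mathcal{R}(\mathbf{w})=1\}$; 3. $\mathbf{w}^*=\mathbf{a}\,\mathrm{III}_M(\cdot-t_0)$ for some $t_0\in\mathbb{T}_M$ and some $\mathbf{a}\in\mathbb{R}^2$ with $\|\mathbf{a}\|_2=1$. Here an extreme point of a set $B$ (convex or not) is a point of $B$ that does not lie strictly between two distinct points of $B$. -/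

import Mathlib

open MeasureTheory
open scoped ContDiff ENNReal

noncomputable section

namespace RITV

/-- The space `𝒮(𝕋_M)` of real `M`-periodic smooth functions, seen as functions on the circle
`𝕋_M = ℝ / Mℤ`: those `φ` for which the `M`-periodic function `t ↦ φ (t mod M)` on the real line
is infinitely differentiable. -/
def TestSpace (M : ℝ) : Set (AddCircle M → ℝ) :=
  {φ | ContDiff ℝ ∞ (fun t : ℝ => φ (t : AddCircle M))}

/-- The space `ℳ(𝕋_M)` of `M`-periodic finite (signed, real) Radon measures: finite signed Borel
measures on the circle `𝕋_M`. As the circle is compact and metrizable, all of them are Radon. -/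
abbrev RadonMeasure (M : ℝ) : Type := SignedMeasure (AddCircle M)

/-- The duality product `⟨w, φ⟩ = ∫ φ dw` of a signed measure and a function. -/
def pairing {M : ℝ} (w : RadonMeasure M) (φ : AddCircle M → ℝ) : ℝ :=
  w.integral φ (ContinuousLinearMap.lsmul ℝ ℝ)

/-- The mixed norm `‖φ‖_{2,∞} = sup_t ‖(φ₁(t), φ₂(t))‖₂`, where `‖·‖₂` is the Euclidean norm. -/
def mixedNorm {M : ℝ} (φ : Fin 2 → AddCircle M → ℝ) : ℝ≥0∞ :=
  ⨆ t : AddCircle M, ‖(WithLp.toLp 2 (fun i => φ i t) : EuclideanSpace ℝ (Fin 2))‖ₑ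

/-- The rotation-invariant total-variation (TV-ℓ₂) norm of a vector-valued measure,
`ℛ(w) = sup {⟨w₁, φ₁⟩ + ⟨w₂, φ₂⟩ : φ₁, φ₂ ∈ 𝒮(𝕋_M), ‖(φ₁, φ₂)‖_{2,∞} = 1}`,
the supremum being taken in the extended reals. -/
def riTV {M : ℝ} (w : Fin 2 → RadonMeasure M) : EReal :=
  ⨆ φ ∈ {φ : Fin 2 → AddCircle M → ℝ | (∀ i, φ i ∈ TestSpace M) ∧ mixedNorm φ = 1},
    ((pairing (w 0) (φ 0) + pairing (w 1) (φ 1) : ℝ) : EReal)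

/-- The unit ball of the RI-TV norm in `ℳ(𝕋_M)²`. -/
def unitBall (M : ℝ) : Set (Fin 2 → RadonMeasure M) := {w | riTV w ≤ 1}

/-- The unit sphere of the RI-TV norm in `ℳ(𝕋_M)²`. -/
def unitSphere (M : ℝ) : Set (Fin 2 → RadonMeasure M) := {w | riTV w = 1}

/-- The shifted `M`-periodic Dirac comb `Ш_M(· - t₀) = ∑_{k ∈ ℤ} δ(· - t₀ - M k)`. All the points
`t₀ + M k` are one and the same point of the circle `𝕋_M = ℝ / Mℤ`, and every period contains
exactly one of them, so as an element of `ℳ(𝕋_M)` the comb is the unit mass at the point `t₀`. -/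
def diracComb (M : ℝ) (t₀ : AddCircle M) : RadonMeasure M := VectorMeasure.dirac t₀ 1

/-- The vector-valued Dirac comb `a Ш_M(· - t₀) = (a₁ Ш_M(· - t₀), a₂ Ш_M(· - t₀))`. -/
def vectorDiracComb (M : ℝ) (a : EuclideanSpace ℝ (Fin 2)) (t₀ : AddCircle M) :
    Fin 2 → RadonMeasure M := fun i => a i • diracComb M t₀

end RITV

end

/-! Every vector measure has a polar form `w = h ν`, with `ν` finite and positive and `‖h‖ = 1`
everywhere (`exists_polar`), and its norm is the mass of `ν` (`riTV_polar`): Cauchy–Schwarz bounds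
it above, and smooth fields close to `h` in `L¹(ν)` bound it below.

If `w` is extreme in the sphere, `ν` is a probability. A set `A` with `0 < ν A < 1` would make `w` a
strict convex combination of the normalised restrictions of `h ν` to `A` and `Aᶜ`, two distinct
points of the sphere. So `ν` takes only the values 0 and 1, hence is a Dirac mass.

Conversely, let a comb of unit direction `a` lie between `u` and `v` in the ball. The total mass in
direction `a` is at most 1 on the ball and equals 1 at the comb, hence at `u` and `v`. By
`sum_mul_univ_le_one`, `u = a α` and `v = a β` with `α, β` positive; a mixture of `α` and `β` is a
Dirac mass, so `α` is that mass.

Extreme points of the ball have norm 1, and stay extreme in the smaller sphere, which links the two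
characterisations. -/

namespace RITV

/-! ### Polar decomposition of vector measures -/

section Density

variable {X : Type*} [MeasurableSpace X] {μ : Measure X}

/-- Integration of a bounded function against a signed measure with a density. -/
theorem integral_withDensityᵥ {g φ : X → ℝ} (hg : Measurable g) (hgi : Integrable g μ)
    (hφ : Measurable φ) {C : ℝ} (hC : ∀ x, |φ x| ≤ C) :
    (μ.withDensityᵥ g).integral φ (ContinuousLinearMap.lsmul ℝ ℝ) = ∫ x, φ x * g x ∂μ := by
  have key : ∀ (f : X → ℝ), Measurable f → Integrable f μ →
      Integrable φ (μ.withDensity fun x => ENNReal.ofReal (f x)) ∧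
      Integrable (fun x => (ENNReal.ofReal (f x)).toReal • φ x) μ := by
    intro f hf hfi
    have := isFiniteMeasure_withDensity_ofReal hfi.2
    have h1 : Integrable φ (μ.withDensity fun x => ENNReal.ofReal (f x)) :=
      Integrable.of_bound hφ.aestronglyMeasurable C (.of_forall hC)
    refine ⟨h1, ?_⟩
    rwa [integrable_withDensity_iff_integrable_smul' (by fun_prop) (by simp)] at h1
  obtain ⟨hp, hp'⟩ := key g hg hgi
  obtain ⟨hn, hn'⟩ := key (fun x => - g x) hg.neg hgi.neg
  have := isFiniteMeasure_withDensity_ofReal hgi.2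
  have := isFiniteMeasure_withDensity_ofReal hgi.neg.2
  have hflip : ContinuousLinearMap.lsmul ℝ ℝ = (ContinuousLinearMap.lsmul ℝ ℝ (E := ℝ)).flip := by
    ext; simp
  have e : ∀ (ν : Measure X) [IsFiniteMeasure ν],
      ν.toSignedMeasure.integral φ (ContinuousLinearMap.lsmul ℝ ℝ) = ∫ x, φ x ∂ν := by
    intro ν _
    rw [hflip]
    exact VectorMeasure.integral_toSignedMeasure
  rw [withDensityᵥ_eq_withDensity_pos_part_sub_withDensity_neg_part hgi,
    VectorMeasure.integral_sub_vectorMeasure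
      (by rwa [VectorMeasure.Integrable, Measure.variation_toSignedMeasure])
      (by rwa [VectorMeasure.Integrable, Measure.variation_toSignedMeasure]), e, e,
    integral_withDensity_eq_integral_toReal_smul (by fun_prop) (by simp),
    integral_withDensity_eq_integral_toReal_smul (by fun_prop) (by simp), ← integral_sub hp' hn']
  congr with x
  rcases le_total 0 (g x) with h | h
  · simp [ENNReal.toReal_ofReal, ENNReal.ofReal_of_nonpos (neg_nonpos.2 h), h, mul_comm]
  · simp [ENNReal.toReal_ofReal, ENNReal.ofReal_of_nonpos, h, mul_comm]

/-- The polar form of a vector density: a density with unit length against the measure with the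
length of the original one as its density. -/
theorem exists_unit_withDensityᵥ_eq {ι : Type*} [Fintype ι] [Nonempty ι]
    {g : X → EuclideanSpace ℝ ι} (hg : Measurable g) (hgi : Integrable g μ) :
    ∃ h : X → EuclideanSpace ℝ ι, Measurable h ∧ (∀ x, ‖h x‖ = 1) ∧
      ∀ i, μ.withDensityᵥ (fun x => g x i)
        = (μ.withDensity fun x => ‖g x‖ₑ).withDensityᵥ (fun x => h x i) := by
  classical
  obtain ⟨e, he⟩ := exists_norm_eq (EuclideanSpace ℝ ι) zero_le_one
  have hmz : MeasurableSet {x | g x = 0} := hg (measurableSet_singleton 0)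
  -- The choice of `e` where `g` vanishes is immaterial: the new measure does not charge that set.
  refine ⟨fun x => if g x = 0 then e else ‖g x‖⁻¹ • g x,
    Measurable.ite hmz (by fun_prop) (by fun_prop), fun x => ?_, fun i => ?_⟩
  · beta_reduce
    split_ifs with h
    · exact he
    · rw [norm_smul, norm_inv, norm_norm, inv_mul_cancel₀ (norm_ne_zero_iff.2 h)]
  · have hx : (fun x => g x i) = fun x => (‖g x‖ₑ).toReal •
        (if g x = 0 then e else ‖g x‖⁻¹ • g x) i := by
      ext x
      split_ifs with h
      · simp [h]
      · simp [mul_inv_cancel_left₀ (norm_ne_zero_iff.2 h)]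
    have hi : Integrable (fun x => g x i) μ := by
      refine hgi.norm.mono' (by fun_prop) (.of_forall fun x => ?_)
      exact PiLp.norm_apply_le (g x) i
    rw [← withDensityᵥ_smul_eq_withDensityᵥ_withDensity' (by fun_prop) (by simp) (hx ▸ hi), ← hx]

/-- Every finite family of signed measures has a polar form. -/
theorem exists_polar {ι : Type*} [Fintype ι] [Nonempty ι] (w : ι → SignedMeasure X) :
    ∃ (ν : Measure X) (h : X → EuclideanSpace ℝ ι), IsFiniteMeasure ν ∧ Measurable h ∧
      (∀ x, ‖h x‖ = 1) ∧ ∀ i, w i = ν.withDensityᵥ (fun x => h x i) := by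
  -- One positive measure dominating all components, so that Radon–Nikodym applies to each.
  let μ : Measure X := ∑ i, (w i).totalVariation
  have hac : ∀ i, w i ≪ᵥ μ.toENNRealVectorMeasure := fun i => by
    rw [SignedMeasure.absolutelyContinuous_ennreal_iff]
    refine Measure.AbsolutelyContinuous.mk fun s hs h0 => ?_
    rw [VectorMeasure.ennrealToMeasure_apply hs,
      Measure.toENNRealVectorMeasure_apply_measurable hs, Measure.finsetSum_apply] at h0
    exact (Finset.sum_eq_zero_iff.1 h0) i (Finset.mem_univ i)
  have hfin : ∀ i, IsFiniteMeasure (w i).totalVariation := fun i => by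
    unfold SignedMeasure.totalVariation; infer_instance
  have : IsFiniteMeasure μ := by infer_instance
  let g : X → EuclideanSpace ℝ ι := fun x => WithLp.toLp 2 fun i => (w i).rnDeriv μ x
  have hm : ∀ i, Measurable ((w i).rnDeriv μ) := fun i => SignedMeasure.measurable_rnDeriv _ _
  have hg : Measurable g := by fun_prop
  have hgi : Integrable g μ := by
    exact Integrable.of_eval_piLp fun i => SignedMeasure.integrable_rnDeriv _ _
  obtain ⟨h, hh, hn, he⟩ := exists_unit_withDensityᵥ_eq hg hgi
  refine ⟨μ.withDensity fun x => ‖g x‖ₑ, h, ⟨?_⟩, hh, hn, fun i => ?_⟩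
  · simpa using! hgi.2
  · rw [← he i]
    exact (SignedMeasure.withDensityᵥ_rnDeriv_eq (w i) μ (hac i)).symm

end Density

/-! ### Smooth and continuous approximation -/

section Approximation

variable {M : ℝ}

theorem TestSpace.continuous {φ : AddCircle M → ℝ} (hφ : φ ∈ TestSpace M) : Continuous φ :=
  have h : ContDiff ℝ ∞ (fun t : ℝ => φ t) := hφ
  continuous_coinduced_dom.2 h.continuous

theorem TestSpace.const (c : ℝ) : (fun _ => c) ∈ TestSpace M :=
  show ContDiff ℝ ∞ (fun _ : ℝ => c) from contDiff_const

theorem TestSpace.const_mul {φ : AddCircle M → ℝ} (hφ : φ ∈ TestSpace M) (c : ℝ) :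
    (fun t => c * φ t) ∈ TestSpace M :=
  have h : ContDiff ℝ ∞ (fun t : ℝ => φ t) := hφ
  contDiff_const.mul h

/-- Smooth functions are uniformly dense in the continuous functions on the circle. -/
theorem exists_testSpace_abs_sub_le [Fact (0 < M)] {f : AddCircle M → ℝ} (hf : Continuous f)
    {ε : ℝ} (hε : 0 < ε) : ∃ φ ∈ TestSpace M, ∀ t, |φ t - f t| ≤ ε := by
  let F : C(AddCircle M, ℂ) := ⟨fun t => (f t : ℂ), by fun_prop⟩
  have hF : F ∈ (Submodule.span ℂ (Set.range (fourier (T := M)))).topologicalClosure := by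
    rw [span_fourier_closure_eq_top]; trivial
  obtain ⟨p, hp, hd⟩ := Metric.mem_closure_iff.1 hF ε hε
  -- Taking real parts keeps a trigonometric polynomial smooth and does not increase its distance to
  -- the real function `f`.
  refine ⟨fun t => (p t).re, ?_, fun t => ?_⟩
  · have : ContDiff ℝ ∞ (fun t : ℝ => p (t : AddCircle M)) := by
      clear hd
      induction hp using Submodule.span_induction with
      | mem x hx =>
        obtain ⟨n, rfl⟩ := hx
        simp only [fourier_coe_apply]
        have : ContDiff ℝ ∞ (fun t : ℝ => (t : ℂ)) := Complex.ofRealCLM.contDiff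
        fun_prop
      | zero => exact contDiff_const
      | add x y _ _ hx hy => exact hx.add hy
      | smul c x _ hx => exact contDiff_const.mul hx
    exact Complex.reCLM.contDiff.comp this
  · have h1 : ‖p t - F t‖ ≤ ε := by
      rw [← dist_eq_norm, dist_comm]
      exact (ContinuousMap.dist_apply_le_dist t).trans hd.le
    calc |(p t).re - f t| = |(p t - F t).re| := by simp [F]
      _ ≤ ‖p t - F t‖ := Complex.abs_re_le_norm _
      _ ≤ ε := h1

theorem exists_testSpace_norm_sub_le [Fact (0 < M)] {f : AddCircle M → EuclideanSpace ℝ (Fin 2)}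
    (hf : Continuous f) {ε : ℝ} (hε : 0 < ε) :
    ∃ φ : Fin 2 → AddCircle M → ℝ, (∀ i, φ i ∈ TestSpace M) ∧
      ∀ t, ‖WithLp.toLp 2 (fun i => φ i t) - f t‖ ≤ ε := by
  choose φ hφ hd using fun i : Fin 2 =>
    exists_testSpace_abs_sub_le (M := M) (f := fun t => f t i) (by fun_prop) (half_pos hε)
  refine ⟨φ, hφ, fun t => ?_⟩
  rw [EuclideanSpace.norm_eq]
  refine Real.sqrt_le_iff.2 ⟨hε.le, ?_⟩
  have h0 := sq_le_sq' (abs_le.1 (hd 0 t)).1 (abs_le.1 (hd 0 t)).2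
  have h1 := sq_le_sq' (abs_le.1 (hd 1 t)).1 (abs_le.1 (hd 1 t)).2
  simp only [Fin.sum_univ_two, PiLp.sub_apply, Real.norm_eq_abs, sq_abs]
  nlinarith

/-- A field of unit vectors is approximated in mean by continuous fields in the unit ball. -/
theorem exists_continuous_norm_le_one_integral_norm_sub_le {X E : Type*} [TopologicalSpace X]
    [NormalSpace X] [MeasurableSpace X] [BorelSpace X] [NormedAddCommGroup E] [NormedSpace ℝ E]
    {ν : Measure X} [ν.WeaklyRegular] {h : X → E} (hi : Integrable h ν) (hn : ∀ x, ‖h x‖ = 1)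
    {ε : ℝ} (hε : 0 < ε) :
    ∃ f : X → E, Continuous f ∧ (∀ x, ‖f x‖ ≤ 1) ∧ ∫ x, ‖f x - h x‖ ∂ν ≤ ε := by
  obtain ⟨g, hg, hgi⟩ := hi.exists_boundedContinuous_integral_sub_le (half_pos hε)
  have hpos : ∀ x, 0 < max 1 ‖g x‖ := fun x => lt_max_of_lt_left one_pos
  -- Radial retraction onto the unit ball. It moves `g x` by at most `‖h x - g x‖`, since `‖h x‖ =
  -- 1`; the total error at most doubles, hence the `ε / 2` above.
  refine ⟨fun x => (max 1 ‖g x‖)⁻¹ • g x, ?_, fun x => ?_, ?_⟩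
  · exact ((continuous_const.max g.continuous.norm).inv₀ fun x => (hpos x).ne').smul g.continuous
  · rw [norm_smul, norm_inv, Real.norm_of_nonneg (hpos x).le]
    exact inv_mul_le_one_of_le₀ (le_max_right _ _) (hpos x).le
  · have hpt : ∀ x, ‖(max 1 ‖g x‖)⁻¹ • g x - h x‖ ≤ 2 * ‖h x - g x‖ := by
      intro x
      have h1 : ‖(max 1 ‖g x‖)⁻¹ • g x - g x‖ ≤ ‖h x - g x‖ := by
        rcases le_total ‖g x‖ 1 with hle | hle
        · simp [max_eq_left hle]
        · have hp : 0 < ‖g x‖ := one_pos.trans_le hle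
          have : (‖g x‖⁻¹ • g x - g x) = (‖g x‖⁻¹ - 1) • g x := by rw [sub_smul, one_smul]
          rw [max_eq_right hle, this, norm_smul, Real.norm_eq_abs,
            abs_of_nonpos (sub_nonpos.2 (inv_le_one_of_one_le₀ hle)), neg_sub, sub_mul,
            inv_mul_cancel₀ hp.ne', one_mul, ← hn x, norm_sub_rev (h x)]
          exact norm_sub_norm_le _ _
      calc _ ≤ ‖(max 1 ‖g x‖)⁻¹ • g x - g x‖ + ‖g x - h x‖ := norm_sub_le_norm_sub_add_norm_sub ..
        _ ≤ _ := by rw [norm_sub_rev (g x) (h x)]; linarith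
    calc _ ≤ ∫ x, 2 * ‖h x - g x‖ ∂ν :=
          integral_mono_of_nonneg (.of_forall fun x => norm_nonneg _)
            ((hi.sub hgi).norm.const_mul 2) (.of_forall hpt)
      _ ≤ ε := by rw [integral_const_mul]; linarith

end Approximation

/-! ### The RI-TV norm as a mass -/

section Norm

variable {M : ℝ}

theorem pairing_add_pairing_withDensityᵥ {ν : Measure (AddCircle M)}
    [Fact (0 < M)] {h : AddCircle M → EuclideanSpace ℝ (Fin 2)} (hm : Measurable h) (hi : Integrable h ν)
    {φ : Fin 2 → AddCircle M → ℝ} (hφ : ∀ i, φ i ∈ TestSpace M) :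
    pairing (ν.withDensityᵥ fun x => h x 0) (φ 0) + pairing (ν.withDensityᵥ fun x => h x 1) (φ 1)
      = ∫ x, inner ℝ (WithLp.toLp 2 fun i => φ i x) (h x) ∂ν := by
  have hc : ∀ i, Continuous (φ i) := fun i => TestSpace.continuous (hφ i)
  have hb : ∀ i, ∃ C, ∀ x, |φ i x| ≤ C := fun i => by
    obtain ⟨C, hC⟩ := isCompact_univ.exists_bound_of_continuousOn (hc i).continuousOn
    exact ⟨C, fun x => hC x trivial⟩
  have hj : ∀ i, Integrable (fun x => φ i x * h x i) ν := fun i => by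
    obtain ⟨C, hC⟩ := hb i
    exact (hi.eval_piLp i).bdd_mul (hc i).measurable.aestronglyMeasurable (.of_forall hC)
  have he : ∀ i, pairing (ν.withDensityᵥ fun x => h x i) (φ i) = ∫ x, φ i x * h x i ∂ν := fun i =>
    (hb i).elim fun C hC =>
      integral_withDensityᵥ (by fun_prop) (hi.eval_piLp i) (hc i).measurable hC
  rw [he, he, ← integral_add (hj 0) (hj 1)]
  simp [PiLp.inner_apply, mul_comm]

theorem mixedNorm_eq_one {φ : Fin 2 → AddCircle M → ℝ} {t : AddCircle M}
    (hle : ∀ s, ‖(WithLp.toLp 2 fun i => φ i s : EuclideanSpace ℝ (Fin 2))‖ ≤ 1)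
    (ht : ‖(WithLp.toLp 2 fun i => φ i t : EuclideanSpace ℝ (Fin 2))‖ = 1) :
    mixedNorm φ = 1 := by
  refine le_antisymm (iSup_le fun s => ?_) (le_iSup_of_le t ?_)
  · rw [← ofReal_norm]
    exact ENNReal.ofReal_le_one.2 (hle s)
  · rw [← ofReal_norm, ht, ENNReal.ofReal_one]

theorem norm_le_one_of_mixedNorm_eq_one {φ : Fin 2 → AddCircle M → ℝ} (h : mixedNorm φ = 1)
    (t : AddCircle M) : ‖(WithLp.toLp 2 fun i => φ i t : EuclideanSpace ℝ (Fin 2))‖ ≤ 1 := by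
  have := (le_iSup (fun t => ‖(WithLp.toLp 2 (fun i => φ i t) : EuclideanSpace ℝ (Fin 2))‖ₑ)
    t).trans h.le
  rwa [← ofReal_norm, ENNReal.ofReal_le_one] at this

theorem le_riTV {w : Fin 2 → RadonMeasure M} {φ : Fin 2 → AddCircle M → ℝ}
    (hφ : ∀ i, φ i ∈ TestSpace M) (h : mixedNorm φ = 1) :
    ((pairing (w 0) (φ 0) + pairing (w 1) (φ 1) : ℝ) : EReal) ≤ riTV w :=
  le_iSup₂_of_le φ ⟨hφ, h⟩ le_rfl

theorem pairing_const_mul (w : RadonMeasure M) (c : ℝ) (φ : AddCircle M → ℝ) :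
    pairing w (fun t => c * φ t) = c * pairing w φ :=
  VectorMeasure.integral_fun_smul _ _ c φ

theorem exists_unit_vector : ∃ e : EuclideanSpace ℝ (Fin 2), ‖e‖ = 1 :=
  exists_norm_eq _ zero_le_one

theorem riTV_nonneg (w : Fin 2 → RadonMeasure M) : 0 ≤ riTV w := by
  obtain ⟨e, he⟩ := exists_unit_vector
  have key : ∀ c : ℝ, |c| = 1 →
      ((c * (pairing (w 0) (fun _ => e 0) + pairing (w 1) (fun _ => e 1)) : ℝ) : EReal)
        ≤ riTV w := fun c hc => by
    have hn : ∀ s : AddCircle M,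
        ‖(WithLp.toLp 2 fun i => c * e i : EuclideanSpace ℝ (Fin 2))‖ = 1 := fun s => by
      have : (WithLp.toLp 2 fun i => c * e i : EuclideanSpace ℝ (Fin 2)) = c • e := rfl
      rw [this, norm_smul, he, Real.norm_eq_abs, hc, one_mul]
    have := le_riTV (w := w) (φ := fun i _ => c * e i) (fun i => TestSpace.const _)
      (mixedNorm_eq_one (t := 0) (fun s => (hn s).le) (hn 0))
    rwa [pairing_const_mul (w 0) c (fun _ => e 0), pairing_const_mul (w 1) c (fun _ => e 1),
      ← mul_add] at this
  rcases le_total 0 (pairing (w 0) (fun _ => e 0) + pairing (w 1) (fun _ => e 1)) with h | h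
  · exact (EReal.coe_nonneg.2 (by simpa using h)).trans (key 1 (by simp))
  · exact (EReal.coe_nonneg.2 (by linarith)).trans (key (-1) (by simp))

/-- The norm only tests fields of sup norm exactly 1. A positive pairing forces the maximum `s` of
the field to be positive, and division by `s ≤ r` gives at least as much as division by `r`;
otherwise `riTV_nonneg` suffices. -/
theorem pairing_div_le_riTV [Fact (0 < M)] (w : Fin 2 → RadonMeasure M) {φ : Fin 2 → AddCircle M → ℝ}
    (hφ : ∀ i, φ i ∈ TestSpace M) {r : ℝ} (hr : 0 < r)
    (hle : ∀ t, ‖(WithLp.toLp 2 fun i => φ i t : EuclideanSpace ℝ (Fin 2))‖ ≤ r) :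
    ((r⁻¹ * (pairing (w 0) (φ 0) + pairing (w 1) (φ 1)) : ℝ) : EReal) ≤ riTV w := by
  set P := pairing (w 0) (φ 0) + pairing (w 1) (φ 1) with hP
  rcases le_or_gt P 0 with hP0 | hP0
  · exact (EReal.coe_nonpos.2 (mul_nonpos_of_nonneg_of_nonpos (by positivity) hP0)).trans
      (riTV_nonneg w)
  have hc : ∀ i, Continuous (φ i) := fun i => TestSpace.continuous (hφ i)
  have hcn : Continuous fun t => ‖(WithLp.toLp 2 fun i => φ i t : EuclideanSpace ℝ (Fin 2))‖ := by
    fun_prop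
  obtain ⟨t, -, ht⟩ := isCompact_univ.exists_isMaxOn Set.univ_nonempty hcn.continuousOn
  set s := ‖(WithLp.toLp 2 fun i => φ i t : EuclideanSpace ℝ (Fin 2))‖ with hs
  have hts : ∀ x, ‖(WithLp.toLp 2 fun i => φ i x : EuclideanSpace ℝ (Fin 2))‖ ≤ s :=
    fun x => ht (Set.mem_univ x)
  have hs0 : 0 < s := by
    refine (norm_nonneg _).lt_of_ne fun h0 => hP0.ne' ?_
    have hz : ∀ i x, φ i x = 0 := fun i x => by
      have := (PiLp.norm_apply_le (WithLp.toLp 2 fun i => φ i x : EuclideanSpace ℝ (Fin 2))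
        i).trans ((hts x).trans h0.symm.le)
      simpa using this
    have : ∀ i, pairing (w i) (φ i) = 0 := fun i => by
      rw [funext (hz i)]
      exact VectorMeasure.integral_zero
    rw [hP, this, this, add_zero]
  have hn : ∀ x, ‖(WithLp.toLp 2 fun i => s⁻¹ * φ i x : EuclideanSpace ℝ (Fin 2))‖
      = s⁻¹ * ‖(WithLp.toLp 2 fun i => φ i x : EuclideanSpace ℝ (Fin 2))‖ := fun x => by
    have : (WithLp.toLp 2 fun i => s⁻¹ * φ i x : EuclideanSpace ℝ (Fin 2))
      = s⁻¹ • WithLp.toLp 2 fun i => φ i x := rfl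
    rw [this, norm_smul, Real.norm_of_nonneg (by positivity)]
  have key := le_riTV (w := w) (φ := fun i x => s⁻¹ * φ i x)
    (fun i => TestSpace.const_mul (hφ i) _)
    (mixedNorm_eq_one (t := t) (fun x => by
      rw [hn]; exact inv_mul_le_one_of_le₀ (hts x) hs0.le)
      (by rw [hn, ← hs, inv_mul_cancel₀ hs0.ne']))
  rw [pairing_const_mul, pairing_const_mul, ← mul_add, ← hP] at key
  refine le_trans (EReal.coe_le_coe_iff.2 ?_) key
  have : s ≤ r := hle t
  gcongr

/-- The RI-TV norm of a measure in polar form is the mass of its length. -/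
theorem riTV_polar [Fact (0 < M)] {ν : Measure (AddCircle M)} [IsFiniteMeasure ν]
    {h : AddCircle M → EuclideanSpace ℝ (Fin 2)} (hm : Measurable h) (hn : ∀ x, ‖h x‖ = 1) :
    riTV (fun i => ν.withDensityᵥ fun x => h x i) = (ν.real Set.univ : EReal) := by
  have hi : Integrable h ν :=
    Integrable.of_bound hm.aestronglyMeasurable 1 (.of_forall fun x => (hn x).le)
  refine le_antisymm (iSup₂_le fun φ hφ => ?_) ?_
  · rw [pairing_add_pairing_withDensityᵥ hm hi hφ.1, EReal.coe_le_coe_iff]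
    have : ‖∫ x, inner ℝ (WithLp.toLp 2 fun i => φ i x) (h x) ∂ν‖ ≤ 1 * ν.real Set.univ :=
      norm_integral_le_of_norm_le_const (.of_forall fun x => by
        refine (norm_inner_le_norm _ _).trans ?_
        rw [hn, mul_one]
        exact norm_le_one_of_mixedNorm_eq_one hφ.2 x)
    exact (le_abs_self _).trans (this.trans (one_mul _).le)
  set m := ν.real Set.univ with hmdef
  -- The loss `ε` is the mean error of a continuous `f` against `h`, `ε * m` the uniform error of a
  -- smooth `φ` against `f`, and `(1 + ε)⁻¹` normalises `φ`.
  have key : ∀ ε : ℝ, 0 < ε →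
      (((1 + ε)⁻¹ * (m - ε - ε * m) : ℝ) : EReal) ≤
        riTV (fun i => ν.withDensityᵥ fun x => h x i) := by
    intro ε hε
    obtain ⟨f, hf, hf1, hfh⟩ := exists_continuous_norm_le_one_integral_norm_sub_le hi hn hε
    obtain ⟨φ, hφ, hφf⟩ := exists_testSpace_norm_sub_le hf hε
    have hc : ∀ i, Continuous (φ i) := fun i => TestSpace.continuous (hφ i)
    have hle : ∀ t, ‖(WithLp.toLp 2 fun i => φ i t : EuclideanSpace ℝ (Fin 2))‖ ≤ 1 + ε :=
      fun t => by
        have := norm_sub_norm_le (WithLp.toLp 2 fun i => φ i t : EuclideanSpace ℝ (Fin 2)) (f t)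
        linarith [hf1 t, hφf t]
    refine le_trans (EReal.coe_le_coe_iff.2 ?_) (pairing_div_le_riTV _ hφ (by positivity) hle)
    rw [pairing_add_pairing_withDensityᵥ hm hi hφ]
    gcongr
    have hfi : Integrable f ν :=
      Integrable.of_bound hf.measurable.aestronglyMeasurable 1 (.of_forall hf1)
    have hd : Integrable (fun x => ‖f x - h x‖) ν := (hfi.sub hi).norm
    have hin : Integrable (fun x => inner ℝ (WithLp.toLp 2 fun i => φ i x) (h x)) ν := by
      refine Integrable.of_bound (Measurable.aestronglyMeasurable ?_) (1 + ε)
        (.of_forall fun x => ?_)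
      · have : Measurable fun x => (WithLp.toLp 2 fun i => φ i x : EuclideanSpace ℝ (Fin 2)) := by
          fun_prop
        exact this.inner hm
      · refine (norm_inner_le_norm _ _).trans ?_
        rw [hn, mul_one]
        exact hle x
    calc m - ε - ε * m ≤ m - ∫ x, ‖f x - h x‖ ∂ν - ε * m := by linarith
      _ = ∫ x, (1 - ‖f x - h x‖ - ε) ∂ν := by
        have hs : Integrable (fun x => 1 - ‖f x - h x‖) ν := (integrable_const _).sub hd
        rw [integral_sub hs (integrable_const _), integral_sub (integrable_const _) hd]
        simp [hmdef, mul_comm]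
      _ ≤ _ := by
        refine integral_mono (((integrable_const _).sub hd).sub (integrable_const _)) hin
          fun x => ?_
        set p : EuclideanSpace ℝ (Fin 2) := WithLp.toLp 2 fun i => φ i x with hp
        have h1 : inner ℝ p (h x) = 1 + inner ℝ (p - h x) (h x) := by
          rw [inner_sub_left, real_inner_self_eq_norm_sq, hn]; ring
        have h2 := neg_le_of_abs_le (abs_real_inner_le_norm (p - h x) (h x))
        rw [hn, mul_one] at h2
        have h3 : ‖p - h x‖ ≤ ‖p - f x‖ + ‖f x - h x‖ := norm_sub_le_norm_sub_add_norm_sub ..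
        have h4 : ‖p - f x‖ ≤ ε := hφf x
        change 1 - ‖f x - h x‖ - ε ≤ inner ℝ p (h x)
        rw [h1]
        linarith
  have hlim : Filter.Tendsto (fun ε : ℝ => (1 + ε)⁻¹ * (m - ε - ε * m)) (nhdsWithin 0 (Set.Ioi 0))
      (nhds m) := by
    have : ContinuousAt (fun ε : ℝ => (1 + ε)⁻¹ * (m - ε - ε * m)) 0 := by
      fun_prop (disch := norm_num)
    simpa using (this.tendsto).mono_left nhdsWithin_le_nhds
  exact le_of_tendsto (continuous_coe_real_ereal.continuousAt.tendsto.comp hlim)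
    (eventually_mem_nhdsWithin.mono fun ε hε => key ε hε)

/-- The RI-TV norm of a measure with a vector density. -/
theorem riTV_withDensityᵥ [Fact (0 < M)] {μ : Measure (AddCircle M)}
    {g : AddCircle M → EuclideanSpace ℝ (Fin 2)} (hg : Measurable g) (hgi : Integrable g μ) :
    riTV (fun i => μ.withDensityᵥ fun x => g x i) = ((∫ x, ‖g x‖ ∂μ : ℝ) : EReal) := by
  obtain ⟨h, hm, hn, he⟩ := exists_unit_withDensityᵥ_eq hg hgi
  have : IsFiniteMeasure (μ.withDensity fun x => ‖g x‖ₑ) := ⟨by simpa using! hgi.2⟩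
  rw [funext he, riTV_polar hm hn, integral_norm_eq_lintegral_enorm hgi.aestronglyMeasurable,
    measureReal_def, withDensity_apply _ MeasurableSet.univ, Measure.restrict_univ]

end Norm

/-! ### Extreme points of the ball and of the sphere -/

section Extreme

variable {M : ℝ} [Fact (0 < M)]

omit [Fact (0 < M)] in
theorem vectorDiracComb_eq_withDensityᵥ (a : EuclideanSpace ℝ (Fin 2)) (t₀ : AddCircle M) :
    vectorDiracComb M a t₀ = fun i => (Measure.dirac t₀).withDensityᵥ fun _ => a i := by
  funext i
  ext S hS
  rw [withDensityᵥ_apply (integrable_const _) hS, setIntegral_const, vectorDiracComb,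
    smul_apply, diracComb, measureReal_def, Measure.dirac_apply' _ hS]
  by_cases h : t₀ ∈ S
  · simp [VectorMeasure.dirac_apply_of_mem hS h, h]
  · simp [VectorMeasure.dirac_apply_of_notMem h, h]

theorem riTV_vectorDiracComb (a : EuclideanSpace ℝ (Fin 2)) (t₀ : AddCircle M) :
    riTV (vectorDiracComb M a t₀) = (‖a‖ : EReal) := by
  rw [vectorDiracComb_eq_withDensityᵥ,
    riTV_withDensityᵥ (g := fun _ => a) measurable_const (integrable_const _)]
  simp

/-- The RI-TV norm dominates the total mass in each direction, and equality forces the measure to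
point in that direction everywhere. -/
theorem sum_mul_univ_le_one {a : EuclideanSpace ℝ (Fin 2)} (ha : ‖a‖ = 1)
    {w : Fin 2 → RadonMeasure M} (hw : riTV w ≤ 1) :
    ∑ i, a i * w i Set.univ ≤ 1 ∧ (1 ≤ ∑ i, a i * w i Set.univ →
      ∃ ν : Measure (AddCircle M), IsFiniteMeasure ν ∧
        ∀ i S, MeasurableSet S → w i S = a i * ν.real S) := by
  obtain ⟨ν, h, hν, hm, hn, he⟩ := exists_polar w
  have hi : Integrable h ν :=
    Integrable.of_bound hm.aestronglyMeasurable 1 (.of_forall fun x => (hn x).le)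
  have hmass : ν.real Set.univ ≤ 1 := by
    rw [funext he, riTV_polar hm hn] at hw
    exact_mod_cast hw
  have hle : ∀ x, inner ℝ a (h x) ≤ 1 := fun x => by
    simpa [ha, hn] using real_inner_le_norm a (h x)
  have hin : Integrable (fun x => inner ℝ a (h x)) ν := hi.const_inner a
  have hsum : ∑ i, a i * w i Set.univ = ∫ x, inner ℝ a (h x) ∂ν := by
    simp only [PiLp.inner_apply]
    rw [integral_finsetSum _ fun i _ => (hi.eval_piLp i).const_inner (a i)]
    refine Finset.sum_congr rfl fun i _ => ?_
    rw [he i, withDensityᵥ_apply (hi.eval_piLp i) MeasurableSet.univ, Measure.restrict_univ,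
      ← integral_const_mul]
    simp [mul_comm]
  have hconst : ∫ x, inner ℝ a (h x) ∂ν ≤ ν.real Set.univ := by
    simpa using integral_mono hin (integrable_const (1 : ℝ)) hle
  refine ⟨hsum ▸ hconst.trans hmass, fun h1 => ⟨ν, hν, fun i S hS => ?_⟩⟩
  -- Equality case of Cauchy–Schwarz: a nonnegative integrand with zero integral vanishes, so `h =
  -- a` almost everywhere.
  have hz : ∫ x, (1 - inner ℝ a (h x)) ∂ν = 0 := by
    refine le_antisymm ?_ (integral_nonneg fun x => sub_nonneg.2 (hle x))
    rw [integral_sub (integrable_const _) hin, ← hsum]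
    simp only [integral_const, smul_eq_mul, mul_one]
    linarith
  have hae := (integral_eq_zero_iff_of_nonneg (fun x => sub_nonneg.2 (hle x))
    ((integrable_const _).sub hin)).1 hz
  have hae' : ∀ᵐ x ∂ν, h x = a := hae.mono fun x hx =>
    ((inner_eq_one_iff_of_norm_eq_one ha (hn x)).1 (sub_eq_zero.1 hx).symm).symm
  rw [he i, withDensityᵥ_apply (hi.eval_piLp i) hS,
    integral_congr_ae (g := fun _ => a i) ((ae_restrict_of_ae hae').mono fun x hx => by simp [hx]),
    setIntegral_const, smul_eq_mul, mul_comm]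

theorem vectorDiracComb_mem_extremePoints_unitBall {a : EuclideanSpace ℝ (Fin 2)} (ha : ‖a‖ = 1)
    (t₀ : AddCircle M) : vectorDiracComb M a t₀ ∈ (unitBall M).extremePoints ℝ := by
  refine ⟨by simp [unitBall, riTV_vectorDiracComb, ha], fun u hu v hv huv => ?_⟩
  obtain ⟨s, r, hs, hr, hsr, huv⟩ := huv
  have happ : ∀ i S, MeasurableSet S →
      s * u i S + r * v i S = a i * (Measure.dirac t₀).real S := fun i S hS => by
    have := congrArg (fun w : Fin 2 → RadonMeasure M => w i S) huv
    rw [vectorDiracComb_eq_withDensityᵥ] at this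
    simpa [withDensityᵥ_apply (integrable_const _) hS, mul_comm (a i)] using this
  have hsum : ∑ i, a i * a i = 1 := by
    have := EuclideanSpace.real_norm_sq_eq a
    rw [ha] at this
    simpa [sq] using this.symm
  obtain ⟨hu1, hu2⟩ := sum_mul_univ_le_one ha hu
  obtain ⟨hv1, hv2⟩ := sum_mul_univ_le_one ha hv
  have htot : s * ∑ i, a i * u i Set.univ + r * ∑ i, a i * v i Set.univ = 1 := by
    rw [← hsum, Finset.mul_sum, Finset.mul_sum, ← Finset.sum_add_distrib]
    refine Finset.sum_congr rfl fun i _ => ?_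
    have := happ i _ MeasurableSet.univ
    rw [probReal_univ] at this
    linear_combination a i * this
  have hu3 : 1 ≤ ∑ i, a i * u i Set.univ := by nlinarith
  have hv3 : 1 ≤ ∑ i, a i * v i Set.univ := by nlinarith
  obtain ⟨α, hα, hue⟩ := hu2 hu3
  obtain ⟨β, hβ, hve⟩ := hv2 hv3
  have hmix : ∀ S, MeasurableSet S → s * α.real S + r * β.real S = (Measure.dirac t₀).real S := by
    intro S hS
    -- A coordinate of `a` may vanish, so instead of dividing by it, multiply by it and sum, using
    -- `‖a‖ = 1`.
    have : ∀ i, a i * a i * (s * α.real S + r * β.real S)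
        = a i * a i * (Measure.dirac t₀).real S := fun i => by
      have := happ i S hS
      rw [hue i S hS, hve i S hS] at this
      linear_combination a i * this
    have := Finset.sum_congr (s₁ := Finset.univ) rfl fun i _ => this i
    rwa [← Finset.sum_mul, ← Finset.sum_mul, hsum, one_mul, one_mul] at this
  have hα1 : α.real Set.univ = 1 := by
    have h1 : ∑ i, a i * u i Set.univ = α.real Set.univ := by
      rw [← one_mul (α.real _), ← hsum, Finset.sum_mul]
      exact Finset.sum_congr rfl fun i _ => by rw [hue i _ MeasurableSet.univ]; ring
    linarith
  have hnull : ∀ S, MeasurableSet S → t₀ ∉ S → α.real S = 0 := fun S hS ht => by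
    have := hmix S hS
    rw [measureReal_def (Measure.dirac t₀), Measure.dirac_apply' _ hS,
      Set.indicator_of_notMem ht, ENNReal.toReal_zero] at this
    have h1 : 0 ≤ α.real S := measureReal_nonneg
    have h2 : 0 ≤ β.real S := measureReal_nonneg
    nlinarith [mul_nonneg hr.le h2, mul_nonneg hs.le h1]
  funext i
  ext S hS
  rw [hue i S hS, vectorDiracComb_eq_withDensityᵥ, withDensityᵥ_apply (integrable_const _) hS,
    setIntegral_const, smul_eq_mul, mul_comm]
  congr 1
  rw [measureReal_def (Measure.dirac t₀), Measure.dirac_apply' _ hS]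
  by_cases ht : t₀ ∈ S
  · have := measureReal_compl hS (μ := α)
    rw [hnull _ hS.compl (by simpa using ht), hα1] at this
    simp only [ht, Set.indicator_of_mem, Pi.one_apply, ENNReal.toReal_one]
    linarith
  · simp [ht, hnull S hS ht]

theorem exists_eq_vectorDiracComb_of_mem_extremePoints_unitSphere {w : Fin 2 → RadonMeasure M}
    (hw : w ∈ (unitSphere M).extremePoints ℝ) :
    ∃ (t₀ : AddCircle M) (a : EuclideanSpace ℝ (Fin 2)),
      ‖a‖ = 1 ∧ w = vectorDiracComb M a t₀ := by
  obtain ⟨hw1, hw2⟩ := hw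
  obtain ⟨ν, h, hν, hm, hn, he⟩ := exists_polar w
  have hi : Integrable h ν :=
    Integrable.of_bound hm.aestronglyMeasurable 1 (.of_forall fun x => (hn x).le)
  have hmass : ν.real Set.univ = 1 := by
    have : riTV w = 1 := hw1
    rw [funext he, riTV_polar hm hn] at this
    exact_mod_cast this
  have hprob : IsProbabilityMeasure ν := ⟨by
    rw [← ofReal_measureReal, hmass, ENNReal.ofReal_one]⟩
  have hz : IsZeroOneMeasure ν := ⟨fun A hA => by
    by_contra! hne
    set c := ν.real A with hc
    have hc0 : 0 < c := measureReal_nonneg.lt_of_ne' fun h0 => hne.1 (by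
      rwa [measureReal_eq_zero_iff] at h0)
    have hc1 : c < 1 := measureReal_le_one.lt_of_ne fun h1 => hne.2 (by
      rw [← ofReal_measureReal, h1, ENNReal.ofReal_one])
    have hcc : ν.real Aᶜ = 1 - c := by rw [measureReal_compl hA, hmass]
    have piece : ∀ B, MeasurableSet B → 0 < ν.real B →
        Measurable (fun x => (ν.real B)⁻¹ • B.indicator h x) ∧
        Integrable (fun x => (ν.real B)⁻¹ • B.indicator h x) ν ∧
        (fun i => ν.withDensityᵥ fun x => ((ν.real B)⁻¹ • B.indicator h x) i) ∈ unitSphere M := by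
      intro B hB hB0
      have h1 : Measurable (fun x => (ν.real B)⁻¹ • B.indicator h x) :=
        (hm.indicator hB).const_smul (ν.real B)⁻¹
      have h2 : Integrable (fun x => (ν.real B)⁻¹ • B.indicator h x) ν := (hi.indicator hB).smul (ν.real B)⁻¹
      refine ⟨h1, h2, ?_⟩
      change riTV _ = 1
      rw [riTV_withDensityᵥ h1 h2]
      simp only [norm_smul, norm_indicator_eq_indicator_norm, hn]
      rw [integral_const_mul, integral_indicator hB]
      simp [abs_of_pos, hB0, hB0.ne']
    obtain ⟨hm1, hi1, hs1⟩ := piece A hA hc0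
    obtain ⟨hm2, hi2, hs2⟩ := piece Aᶜ hA.compl (by linarith)
    have heq := hw2 hs1 hs2 ⟨c, 1 - c, hc0, by linarith, by ring, by
      funext i
      rw [he i, Pi.add_apply, Pi.smul_apply, Pi.smul_apply, ← withDensityᵥ_smul,
        ← withDensityᵥ_smul, ← withDensityᵥ_add ((hi1.eval_piLp i).smul c)
          ((hi2.eval_piLp i).smul (1 - c))]
      congr 1
      funext x
      by_cases hx : x ∈ A
      · simp [hx, ← hc, hc0.ne']
      · have : (1 - c) ≠ 0 := by linarith
        simp [hx, hcc, this]⟩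
    have hae : ∀ i, (fun x => ((ν.real A)⁻¹ • A.indicator h x) i) =ᵐ[ν] fun x => h x i := fun i =>
      (hi1.eval_piLp i).ae_eq_of_withDensityᵥ_eq (hi.eval_piLp i)
        ((congrFun heq i).trans (he i))
    -- Extremality identifies `w` with its piece on `A`, so `h = 0` almost everywhere on `Aᶜ`; but
    -- `h` has unit length.
    have : ν.real Aᶜ = 0 := by
      rw [measureReal_eq_zero_iff]
      refine measure_mono_null (fun x hx => ?_) (ae_iff.1 (ae_all_iff.2 hae))
      intro hall
      have : h x = 0 := by
        ext i
        have := hall i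
        simpa [Set.indicator_of_notMem hx] using this.symm
      simpa [this] using hn x
    linarith⟩
  obtain ⟨t₀, ht⟩ := IsZeroOneMeasure.exists_eq_dirac (μ := ν)
  refine ⟨t₀, h t₀, hn t₀, ?_⟩
  rw [vectorDiracComb_eq_withDensityᵥ, ← ht]
  funext i
  rw [he i]
  refine WithDensityᵥEq.congr_ae ?_
  rw [ht]
  exact ae_eq_dirac fun x => h x i

theorem mem_unitSphere_of_mem_extremePoints_unitBall {w : Fin 2 → RadonMeasure M}
    (hw : w ∈ (unitBall M).extremePoints ℝ) : w ∈ unitSphere M := by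
  obtain ⟨hw1, hw2⟩ := hw
  obtain ⟨ν, h, hν, hm, hn, he⟩ := exists_polar w
  have hi : Integrable h ν :=
    Integrable.of_bound hm.aestronglyMeasurable 1 (.of_forall fun x => (hn x).le)
  have hscale : ∀ c : ℝ, riTV (c • w) = ((|c| * ν.real Set.univ : ℝ) : EReal) := fun c => by
    have : c • w = fun i => ν.withDensityᵥ fun x => (c • h x) i := by
      funext i
      rw [Pi.smul_apply, he i, ← withDensityᵥ_smul]
      rfl
    rw [this, riTV_withDensityᵥ (g := fun x => c • h x) (hm.const_smul c) (hi.smul c)]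
    simp [norm_smul, hn, mul_comm]
  have hone := hscale 1
  rw [one_smul, abs_one, one_mul] at hone
  set r := ν.real Set.univ with hr
  have hr0 : 0 ≤ r := measureReal_nonneg
  have hr1 : r ≤ 1 := by
    have : riTV w ≤ 1 := hw1
    rw [hone] at this
    exact_mod_cast this
  have hzero : riTV (0 : Fin 2 → RadonMeasure M) = 0 := by simpa using hscale 0
  change riTV w = 1
  by_contra hne
  have hr1' : r < 1 := hr1.lt_of_ne fun h1 => hne (by rw [hone, h1]; rfl)
  rcases hr0.eq_or_lt with h0 | h0
  -- Here `w = 0`, the midpoint of two opposite combs in the ball.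
  · obtain ⟨e, he1⟩ := exists_unit_vector
    have hνz : ν = 0 := by
      rw [← Measure.measure_univ_eq_zero, ← measureReal_eq_zero_iff]; exact h0.symm
    have hw0 : w = 0 := by
      funext i
      rw [he i, hνz]
      ext S hS
      rw [withDensityᵥ_apply (by simp) hS]
      simp
    have hball : ∀ b : EuclideanSpace ℝ (Fin 2), ‖b‖ = 1 →
        vectorDiracComb M b 0 ∈ unitBall M := fun b hb =>
      (vectorDiracComb_mem_extremePoints_unitBall hb 0).1
    have := hw2 (hball e he1) (hball (-e) (by rw [norm_neg, he1]))
      ⟨1 / 2, 1 / 2, by norm_num, by norm_num, by norm_num, by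
        rw [hw0]
        funext i
        simp [vectorDiracComb, neg_smul (e i) (diracComb M 0)]⟩
    have h2 := riTV_vectorDiracComb e (0 : AddCircle M)
    rw [this, hw0, hzero, he1] at h2
    norm_num at h2
  -- For `0 < r < 1`, `w` lies strictly between `0` and `r⁻¹ • w`; extremality would give `w = 0`.
  · have := hw2 (x₁ := 0) (x₂ := r⁻¹ • w) (by simp [unitBall, hzero])
      (by
        change riTV _ ≤ 1
        rw [hscale, abs_of_pos (inv_pos.2 h0), inv_mul_cancel₀ h0.ne']
        rfl)
      ⟨1 - r, r, by linarith, h0, by ring, by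
        rw [smul_zero, zero_add, smul_inv_smul₀ h0.ne']⟩
    rw [← this, hzero] at hone
    exact h0.ne (by exact_mod_cast hone)

end Extreme

end RITV

theorem mainTheorem4 (M : ℝ) (hM : 0 < M) (w : Fin 2 → RITV.RadonMeasure M) :
    (w ∈ (RITV.unitBall M).extremePoints ℝ ↔
      ∃ (t₀ : AddCircle M) (a : EuclideanSpace ℝ (Fin 2)),
        ‖a‖ = 1 ∧ w = RITV.vectorDiracComb M a t₀) ∧
    (w ∈ (RITV.unitSphere M).extremePoints ℝ ↔
      ∃ (t₀ : AddCircle M) (a : EuclideanSpace ℝ (Fin 2)),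
        ‖a‖ = 1 ∧ w = RITV.vectorDiracComb M a t₀) := by
  have : Fact (0 < M) := ⟨hM⟩
  have hsub : RITV.unitSphere M ⊆ RITV.unitBall M := fun u (hu : RITV.riTV u = 1) => hu.le
  have hdown : w ∈ RITV.unitSphere M → w ∈ (RITV.unitBall M).extremePoints ℝ →
      w ∈ (RITV.unitSphere M).extremePoints ℝ := fun h1 h2 =>
    inter_extremePoints_subset_extremePoints_of_subset hsub ⟨h1, h2⟩
  refine ⟨⟨fun h => ?_, ?_⟩, fun h => ?_, ?_⟩
  · exact RITV.exists_eq_vectorDiracComb_of_mem_extremePoints_unitSphere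
      (hdown (RITV.mem_unitSphere_of_mem_extremePoints_unitBall h) h)
  · rintro ⟨t₀, a, ha, rfl⟩
    exact RITV.vectorDiracComb_mem_extremePoints_unitBall ha t₀
  · exact RITV.exists_eq_vectorDiracComb_of_mem_extremePoints_unitSphere h
  · rintro ⟨t₀, a, ha, rfl⟩
    have h := RITV.vectorDiracComb_mem_extremePoints_unitBall ha t₀
    exact hdown (RITV.mem_unitSphere_of_mem_extremePoints_unitBall h) h
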